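/- Let $q$ be a prime. A joint symbol is a pair $w=(w_A,w_B)$ with $w_A,w_B\in\{0,\dots,q-1\}$; for a real ratio $\eta\ge 1$ its superimposed symbol is $w_S=\eta w_A+w_B$, and for $\alpha,\beta\in GF(q)\setminus\{0\}$ its network-coded symbol is $\alpha w_A+\beta w_B\in GF(q)$. Let $$d^{(\alpha,\beta)}_{\min}(\eta)=\min\bigl\{|w_S-w'_S| : w\ne w',\ \alpha w_A+\beta w_B\neq\alpha w'_A+\beta w'_B \text{ in } GF(q)\bigr\},\qquad d^{opt}_{\min}(\eta)=\max_{\alpha,\beta\in GF(q)\setminus\{0\}}d^{(\alpha,\beta)}_{\min}(\eta).$$ An even (respectively odd) turning point is an $\eta\ge1$ at which the function $d^{opt}_{\min}:[1,\infty)\to\mathbb R$ has a strict local maximum (respectively strict local minimum); the $i$-th one is the $i$-th in increasing order of $\eta$. The reference symbol is $(0,q-1)$. A characteristic symbol is a joint symbol $(w_A,w_B)$ with $w_A>0$ and $0<w_A+w_B\le q-1$ whose distance to the reference symbol, $|\eta w_A+w_B-(q-1)|$, equals $d^{opt}_{\min}(\eta)$ for all $\eta$ in some nondegenerate interval contained in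 $[1,\infty)$. Then every turning point is rational, and at a turning point $\eta=m/n$ with $m,n$ positive integers and $\gcd(m,n)=1$ we have $d^{opt}_{\min}(\eta)=1/n$. Furthermore, the characteristic symbols overlap with the reference symbol at pairwise distinct ratios $\eta=(q-1-w_B)/w_A$; let $(w^{char}_{A,1},w^{char}_{B,1}),\dots,(w^{char}_{A,I},w^{char}_{B,I})$ be their list in increasing order of this ratio. There are exactly $\max(I-1,0)$ even and exactly $\max(I-1,0)$ odd turning points, and for $1\le i\le I-1$, $$d^{opt}_{\min}=\frac1{w^{char}_{A,i}}\ \text{ at the $i$-th even turning point,}\qquad d^{opt}_{\min}=\frac1{w^{char}_{A,i}+w^{char}_{A,i+1}}\ \text{ at the $i$-th odd turning point.}$$ -/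

import Mathlib

open Set Filter Topology

noncomputable section

/-- Joint symbols `(w_A, w_B)` with `0 ≤ w_A, w_B ≤ q - 1`. -/
abbrev JointSymbol (q : ℕ) : Type := Fin q × Fin q

/-- The superimposed symbol `h_A w_A + h_B w_B`. -/
def superimposed {q : ℕ} (hA hB : ℝ) (w : JointSymbol q) : ℝ :=
  hA * (w.1 : ℕ) + hB * (w.2 : ℕ)

/-- The network-coded symbol `α ⊗ w_A ⊕ β ⊗ w_B`, computed in `GF(q) = ZMod q`. -/
def ncSymbol {q : ℕ} (α β : ZMod q) (w : JointSymbol q) : ZMod q :=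
  α * ((w.1 : ℕ) : ZMod q) + β * ((w.2 : ℕ) : ZMod q)

/-- The distances between superimposed symbols of distinct joint symbols that `(α, β)` maps to
different network-coded symbols. -/
def setDistances (q : ℕ) (hA hB : ℝ) (α β : ZMod q) : Set ℝ :=
  {d | ∃ w w' : JointSymbol q, w ≠ w' ∧ ncSymbol α β w ≠ ncSymbol α β w' ∧
    d = |superimposed hA hB w - superimposed hA hB w'|}

/-- The minimum set distance of the coefficient pair `(α, β)`; the infimum is a minimum, see
`isLeast_minSetDistance`. -/
def minSetDistance (q : ℕ) (hA hB : ℝ) (α β : ZMod q) : ℝ :=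
  sInf (setDistances q hA hB α β)

/-- The minimum set distances of all admissible coefficient pairs, `α ≠ 0` and `β ≠ 0`. -/
def minSetDistances (q : ℕ) (hA hB : ℝ) : Set ℝ :=
  {d | ∃ α β : ZMod q, α ≠ 0 ∧ β ≠ 0 ∧ d = minSetDistance q hA hB α β}

/-- The minimum set distance of an optimal coefficient pair, that is, the largest one; the
supremum is a maximum, see `isGreatest_optMinSetDistance`. -/
def optMinSetDistance (q : ℕ) (hA hB : ℝ) : ℝ :=
  sSup (minSetDistances q hA hB)

/-- The optimal minimum set distance as a function of the channel gain ratio `η = h_A / h_B`,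
normalized by `h_B = 1`. -/
def dOpt (q : ℕ) (η : ℝ) : ℝ := optMinSetDistance q η 1

theorem isLeast_minSetDistance {q : ℕ} (hq : q.Prime) (hA hB : ℝ) {α β : ZMod q} (hα : α ≠ 0) :
    IsLeast (setDistances q hA hB α β) (minSetDistance q hA hB α β) := by
  have hfin : (setDistances q hA hB α β).Finite := by
    refine (Set.finite_range (fun p : JointSymbol q × JointSymbol q =>
      |superimposed hA hB p.1 - superimposed hA hB p.2|)).subset ?_
    rintro d ⟨w, w', -, -, rfl⟩
    exact ⟨(w, w'), rfl⟩
  have hne : (setDistances q hA hB α β).Nonempty := by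
    have h1 := hq.one_lt
    have hN : ncSymbol α β ((⟨1, h1⟩, ⟨0, hq.pos⟩) : JointSymbol q) ≠
        ncSymbol α β ((⟨0, hq.pos⟩, ⟨0, hq.pos⟩) : JointSymbol q) := by
      simpa [ncSymbol] using hα
    exact ⟨_, _, _, fun h => hN (by rw [h]), hN, rfl⟩
  exact ⟨hne.csInf_mem hfin, fun d hd => csInf_le hfin.bddBelow hd⟩

theorem isGreatest_optMinSetDistance {q : ℕ} (hq : q.Prime) (hA hB : ℝ) :
    IsGreatest (minSetDistances q hA hB) (optMinSetDistance q hA hB) := by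
  have : Fact q.Prime := ⟨hq⟩
  have hfin : (minSetDistances q hA hB).Finite := by
    refine (Set.finite_range (fun p : ZMod q × ZMod q => minSetDistance q hA hB p.1 p.2)).subset ?_
    rintro d ⟨α, β, -, -, rfl⟩
    exact ⟨(α, β), rfl⟩
  have hne : (minSetDistances q hA hB).Nonempty := ⟨_, 1, 1, one_ne_zero, one_ne_zero, rfl⟩
  exact ⟨hne.csSup_mem hfin, fun d hd => le_csSup hfin.bddAbove hd⟩

/-- Even turning points: the peaks (strict local maxima) of `dOpt q` on the range `η ≥ 1`. -/
def evenTurningPoints (q : ℕ) : Set ℝ :=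
  {η | 1 ≤ η ∧ ∀ᶠ x in 𝓝[Ici 1 \ {η}] η, dOpt q x < dOpt q η}

/-- Odd turning points: the troughs (strict local minima) of `dOpt q` on the range `η ≥ 1`. -/
def oddTurningPoints (q : ℕ) : Set ℝ :=
  {η | 1 ≤ η ∧ ∀ᶠ x in 𝓝[Ici 1 \ {η}] η, dOpt q η < dOpt q x}

/-- The moving joint symbols on the left of, or overlapping with, the reference symbol
`(0, q - 1)` when `η` goes from `1` to `q - 1`. -/
def leftSymbols (q : ℕ) : Set (JointSymbol q) :=
  {w | 0 < (w.1 : ℕ) + (w.2 : ℕ) ∧ (w.1 : ℕ) + (w.2 : ℕ) ≤ q - 1 ∧ 0 < (w.1 : ℕ)}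

/-- At the ratio `η`, the distance between `w` and the reference symbol `(0, q - 1)` (whose
superimposed symbol is `q - 1`) is the optimal minimum set distance. -/
def IsDetermining (q : ℕ) (η : ℝ) (w : JointSymbol q) : Prop :=
  |superimposed η 1 w - ((q : ℝ) - 1)| = dOpt q η

/-- Characteristic symbols: the symbols of `leftSymbols q` that determine the optimal minimum set
distance throughout some nondegenerate interval of ratios `η ≥ 1`. -/
def characteristicSymbols (q : ℕ) : Set (JointSymbol q) :=
  {w | w ∈ leftSymbols q ∧
    ∃ a b : ℝ, 1 ≤ a ∧ a < b ∧ ∀ η ∈ Icc a b, IsDetermining q η w}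

/-- The ratio `η` at which `w` overlaps with the reference symbol: `η w_A + w_B = q - 1`. -/
def overlapRatio {q : ℕ} (w : JointSymbol q) : ℝ :=
  ((q : ℝ) - 1 - (w.2 : ℕ)) / (w.1 : ℕ)

/-- `s 1, …, s N` lists the elements of `S`, each exactly once, in strictly increasing order of
`key`. -/
def ListsInOrder {X : Type} (key : X → ℝ) (S : Set X) (N : ℕ) (s : ℕ → X) : Prop :=
  BijOn s (Icc 1 N) S ∧ StrictMonoOn (fun i => key (s i)) (Icc 1 N)

end

/-!
The distance of two superimposed symbols is `|η a + b|`, where `(a, b)` is the difference of the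
joint symbols, and an admissible pair `(α, β)` may disregard the differences with
`α a + β b = 0` in `ZMod q`. Let `m / n < m' / n'` be neighbours in the list of reduced fractions
in `[1, q - 1]` with numerator below `q`. As in the theory of Farey sequences, `m' n - m n' = 1` and
`m + m' ≥ q` (`FareyNeighbours.of_gap`). Hence `(n, -m)` and `(n', -m')` form a basis of `ℤ²`. For
`m / n ≤ η ≤ m' / n'` their values are `η n - m ≥ 0` and `m' - η n' ≥ 0` up to sign, and a difference
`(a, b)` with `|b| < q` does not have two positive or two negative coordinates, so that `|η a + b|`
is the sum of the two values weighted by the absolute values of the coordinates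
(`FareyNeighbours.le_abs`). The pair
`(m, n)` disregards the first basis vector, the pair `(m', n')` the second, and no pair disregards
both, as their determinant is a unit. Therefore (`FareyNeighbours.dOpt_eq`)

  `dOpt q η = max (η n - m) (m' - η n')` on `[m / n, m' / n']`, and `dOpt q η = 1` for `η ≥ q - 1`.

So `dOpt q` decreases strictly from `1 / n` at `m / n` to `1 / (n + n')` at the mediant
`(m + m') / (n + n')`, and then increases strictly to `1 / n'`. The peaks are the fractions
`m / n < q - 1`, the troughs are the mediants (`FareyChain.even_eq`, `FareyChain.odd_eq`), and the
affine pieces are those of the symbols `(n, q - 1 - m)`, so these are the characteristic symbols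
(`characteristicSymbols_eq`). The peak at `q - 1` is missing because the function is constant from
there on; this accounts for the difference between `I` and `I - 1`.
-/

/-! ### Neighbouring fractions with bounded numerator -/

/-- `m / n < m' / n'` are neighbours among the reduced fractions with numerator below `q`: the
vectors `(n, m)` and `(n', m')` form a basis of the lattice `ℤ²`, and the numerator of the mediant
is too large. The case `n' = 0`, `m' = 1` (the fraction "infinity") is allowed. -/
structure FareyNeighbours (q n m n' m' : ℕ) : Prop where
  pos : 0 < n
  num_pos : 0 < m
  den_lt : n < q
  num_lt : m < q
  den_lt' : n' < q
  num_pos' : 0 < m'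
  num_lt' : m' < q
  det : m' * n = m * n' + 1
  mediant : q ≤ m + m'

/-- Two reduced fractions in `[1, q - 1]` with no further one of numerator below `q` between them
are neighbours. The argument is the classical one for Farey sequences, except that numerators are
bounded instead of denominators. -/
theorem FareyNeighbours.of_gap {q n m n' m' : ℕ} (hn : 0 < n) (hnm : n ≤ m) (hm : m < q)
    (hc : n.Coprime m) (hn' : 0 < n') (hnm' : n' ≤ m') (hm' : m' < q) (hc' : n'.Coprime m')
    (hlt : m * n' < m' * n)
    (hgap : ∀ a c : ℕ, 0 < a → a ≤ c → c < q → a.Coprime c →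
      m * a < c * n → ¬ c * n' < m' * a) :
    FareyNeighbours q n m n' m' := by
  have hgap' : ∀ a c : ℕ, 0 < a → a ≤ c → c < q → m * a < c * n → ¬ c * n' < m' * a := by
    intro a c ha hac hcq h1 h2
    obtain ⟨a', c', hco, hae, hce⟩ := Nat.exists_coprime a c
    have hg : 0 < a.gcd c := Nat.gcd_pos_of_pos_left _ ha
    set g := a.gcd c
    rw [hae] at ha hac h1 h2
    rw [hce] at hac hcq h1 h2
    refine hgap a' c' (Nat.pos_of_mul_pos_right ha) (Nat.le_of_mul_le_mul_right hac hg)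
      (lt_of_le_of_lt (Nat.le_mul_of_pos_right _ hg) hcq) hco ?_ ?_
    · exact lt_of_mul_lt_mul_right (a := g) (by linarith) hg.le
    · exact lt_of_mul_lt_mul_right (a := g) (by linarith) hg.le
  have hmed : q ≤ m + m' := by
    by_contra! h
    exact hgap' (n + n') (m + m') (by omega) (by omega) h (by linarith) (by linarith)
  -- The right neighbour `y / x` of `m / n`: the solution of `y n - m x = 1` with `y` as large as
  -- possible below `q`.
  obtain ⟨x, y, hxy, hy1, hy2⟩ :
      ∃ x y : ℤ, y * n = m * x + 1 ∧ (q : ℤ) ≤ m + y ∧ y < q := by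
    obtain ⟨a, b, hab⟩ := Nat.isCoprime_iff_coprime.2 hc
    have hm0 : (0 : ℤ) < m := by omega
    refine ⟨-b - ((q - 1 - a) / (m : ℤ)) * (-n), q - 1 - (q - 1 - a) % (m : ℤ), ?_, ?_, ?_⟩
    · have := Int.emod_add_mul_ediv (q - 1 - a) (m : ℤ)
      linear_combination hab - (n : ℤ) * this
    · have := Int.emod_lt_of_pos (q - 1 - a) hm0
      omega
    · have := Int.emod_nonneg (q - 1 - a) hm0.ne'
      omega
  have hmZ : (0 : ℤ) < m := by omega
  have hnZ : (0 : ℤ) < n := by omega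
  have hy : 0 < y := by omega
  have hx : 0 < x := by
    by_contra! h
    have h1 : y * n = 1 := by nlinarith
    have h2 : (n : ℤ) = 1 := by nlinarith
    have h3 : y = 1 := by simpa [h2] using h1
    have h4 : n = 1 := by exact_mod_cast h2
    subst h4
    have : m ≤ m * n' := Nat.le_mul_of_pos_right _ hn'
    omega
  lift x to ℕ using hx.le
  lift y to ℕ using hy.le
  norm_cast at hx hy hxy hy1 hy2
  have hxley : x ≤ y := by
    by_contra! h
    have : m * (y + 1) ≤ m * x := Nat.mul_le_mul_left _ h
    have : y * n ≤ y * m := Nat.mul_le_mul_left _ hnm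
    nlinarith
  have hE : m' * x ≤ y * n' := by
    by_contra! h
    exact hgap' x y hx hxley hy2 (by omega) h
  refine ⟨hn, by omega, by omega, hm, by omega, by omega, hm', ?_, hmed⟩
  obtain ⟨D, hD⟩ := Nat.exists_eq_add_of_lt hlt
  obtain ⟨E, hE⟩ := Nat.exists_eq_add_of_le hE
  -- With `D + 1 = m' n - m n'` and `E = y n' - m' x`, the vector identity below expresses `(n', m')`
  -- in the basis `(x, y)`, `(n, m)`; the size of the numerators forces `E = 0`, and then
  -- `D + 1` divides both `n'` and `m'`.
  have h1 : y * (D + 1) + m * E = m' := by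
    zify at *
    linear_combination (-y : ℤ) * hD + (m : ℤ) * (-hE) + (m' : ℤ) * hxy
  have hE0 : E = 0 := by
    by_contra h
    have : m ≤ m * E := Nat.le_mul_of_pos_right _ (by omega)
    have : y ≤ y * (D + 1) := Nat.le_mul_of_pos_right _ (by omega)
    omega
  have h2 : x * (D + 1) = n' := by
    subst hE0
    zify at *
    linear_combination (-x : ℤ) * hD - (n : ℤ) * hE + (n' : ℤ) * hxy
  have h3 : D + 1 ∣ n'.gcd m' := Nat.dvd_gcd ⟨x, by linarith⟩ ⟨y, by rw [← h1, hE0]; ring⟩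
  rw [hc'.gcd_eq_one] at h3
  have := Nat.le_of_dvd one_pos h3
  omega

/-! ### The optimal distance between two neighbours -/

theorem superimposed_sub {q : ℕ} (η : ℝ) (w w' : JointSymbol q) :
    superimposed η 1 w - superimposed η 1 w' =
      η * (((w.1 : ℕ) : ℤ) - ((w'.1 : ℕ) : ℤ) : ℤ) + (((w.2 : ℕ) : ℤ) - ((w'.2 : ℕ) : ℤ) : ℤ) := by
  simp only [superimposed]
  push_cast
  ring

/-- A difference `(n, -m)` that `(α, β)` does not merge is realized by the joint symbols `(n, 0)` and
`(0, m)`. -/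
theorem minSetDistance_le {q : ℕ} (hq : q.Prime) {η : ℝ} {α β : ZMod q} (hα : α ≠ 0) {n m : ℕ}
    (hn : n < q) (hm : m < q) (h : α * n ≠ β * m) :
    minSetDistance q η 1 α β ≤ |η * n - m| := by
  have hN : ncSymbol α β ((⟨n, hn⟩, ⟨0, hq.pos⟩) : JointSymbol q) ≠
      ncSymbol α β ((⟨0, hq.pos⟩, ⟨m, hm⟩) : JointSymbol q) := by
    simpa [ncSymbol] using h
  refine (isLeast_minSetDistance hq η 1 hα).2 ⟨_, _, fun h => hN (by rw [h]), hN, ?_⟩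
  simp [superimposed]

namespace FareyNeighbours

variable {q n m n' m' : ℕ} {η : ℝ}

/-- Distances of superimposed symbols in the basis `(n, -m)`, `(n', -m')` of the lattice of
differences: a vector of the box cannot have both coordinates positive or both negative, so the two
basis contributions to `η a + b` add up without cancellation. -/
theorem le_abs (h : FareyNeighbours q n m n' m') (h1 : (m : ℝ) ≤ η * n) (h2 : η * n' ≤ m')
    {a b : ℤ} (hb : |b| < q) :
    (a * m + b * n ≠ 0 → m' - η * n' ≤ |η * a + b|) ∧
      (a * m' + b * n' ≠ 0 → η * n - m ≤ |η * a + b|) := by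
  have hdet : (m' : ℤ) * n = m * n' + 1 := by exact_mod_cast h.det
  have hmed : (q : ℤ) ≤ m + m' := by exact_mod_cast h.mediant
  have hm : (0 : ℤ) < m := by exact_mod_cast h.num_pos
  have hm' : (0 : ℤ) < m' := by exact_mod_cast h.num_pos'
  obtain ⟨X, hX⟩ : ∃ X : ℤ, X = a * m' + b * n' := ⟨_, rfl⟩
  obtain ⟨Y, hY⟩ : ∃ Y : ℤ, Y = -(a * m + b * n) := ⟨_, rfl⟩
  have ha : a = X * n + Y * n' := by
    rw [hX, hY]; linear_combination (-a) * hdet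
  have hb' : b = -(X * m + Y * m') := by
    rw [hX, hY]; linear_combination (-b) * hdet
  have hval : η * a + b = X * (η * n - m) - Y * (m' - η * n') := by
    rw [ha, hb']; push_cast; ring
  rw [abs_lt] at hb
  rw [← hX, hval, _root_.le_abs, _root_.le_abs]
  have hs : 0 ≤ η * n - m := by linarith
  have hs' : 0 ≤ m' - η * n' := by linarith
  have hsign : (0 ≤ X ∧ Y ≤ 0) ∨ (X ≤ 0 ∧ 0 ≤ Y) := by
    by_contra! hcon
    rcases lt_trichotomy X 0 with hX0 | hX0 | hX0
    · have hY0 : Y < 0 := hcon.2 hX0.le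
      nlinarith
    · have := hcon.1 hX0.ge
      have := hcon.2 hX0.le
      omega
    · have hY0 : 0 < Y := hcon.1 hX0.le
      nlinarith
  rcases hsign with ⟨hX0, hY0⟩ | ⟨hX0, hY0⟩
  · have hXr : (0 : ℝ) ≤ X := by exact_mod_cast hX0
    have hYr : (Y : ℝ) ≤ 0 := by exact_mod_cast hY0
    refine ⟨fun hne => Or.inl ?_, fun hne => Or.inl ?_⟩
    · have : (Y : ℝ) ≤ -1 := by exact_mod_cast (by omega : Y ≤ -1)
      nlinarith
    · have : (1 : ℝ) ≤ X := by exact_mod_cast (by omega : 1 ≤ X)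
      nlinarith
  · have hXr : (X : ℝ) ≤ 0 := by exact_mod_cast hX0
    have hYr : (0 : ℝ) ≤ Y := by exact_mod_cast hY0
    refine ⟨fun hne => Or.inr ?_, fun hne => Or.inr ?_⟩
    · have : (1 : ℝ) ≤ Y := by exact_mod_cast (by omega : 1 ≤ Y)
      nlinarith
    · have : (X : ℝ) ≤ -1 := by exact_mod_cast (by omega : X ≤ -1)
      nlinarith

end FareyNeighbours

theorem natCast_zmod_ne_zero {q k : ℕ} (h0 : 0 < k) (hk : k < q) : (k : ZMod q) ≠ 0 := by
  rw [Ne, ZMod.natCast_eq_zero_iff]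
  exact Nat.not_dvd_of_pos_of_lt h0 hk

/-- The coefficient pair `(m, n)` merges `(n, 0)` with `(0, m)`; so a lower bound for the distances
`|η a + b|` of all differences `(a, b)` not parallel to `(n, -m)` bounds the optimum from below. -/
theorem le_dOpt {q n m : ℕ} (hq : q.Prime) {η δ : ℝ} (hn : 0 < n) (hnq : n < q) (hm : 0 < m)
    (hmq : m < q)
    (h : ∀ a b : ℤ, |b| < q → a * m + b * n ≠ 0 → δ ≤ |η * a + b|) : δ ≤ dOpt q η := by
  have hα := natCast_zmod_ne_zero hm hmq
  refine le_trans ?_ ((isGreatest_optMinSetDistance hq η 1).2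
    ⟨m, n, hα, natCast_zmod_ne_zero hn hnq, rfl⟩)
  obtain ⟨w, w', -, hN, hd⟩ := (isLeast_minSetDistance hq η 1 (β := (n : ZMod q)) hα).1
  rw [hd, superimposed_sub]
  refine h _ _ (abs_lt.2 ⟨by omega, by omega⟩) fun h0 => hN ?_
  have := congrArg (Int.cast : ℤ → ZMod q) h0
  simp only [ncSymbol]
  push_cast at this
  linear_combination this

namespace FareyNeighbours

variable {q n m n' m' : ℕ} {η : ℝ}

theorem left_le_dOpt (h : FareyNeighbours q n m n' m') (hq : q.Prime)
    (h1 : (m : ℝ) ≤ η * n) (h2 : η * n' ≤ m') : m' - η * n' ≤ dOpt q η :=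
  le_dOpt hq h.pos h.den_lt h.num_pos h.num_lt fun _ _ hb => (h.le_abs h1 h2 hb).1

theorem right_le_dOpt (h : FareyNeighbours q n m n' m') (hq : q.Prime) (hn' : 0 < n')
    (h1 : (m : ℝ) ≤ η * n) (h2 : η * n' ≤ m') : η * n - m ≤ dOpt q η :=
  le_dOpt hq hn' h.den_lt' h.num_pos' h.num_lt' fun _ _ hb => (h.le_abs h1 h2 hb).2

/-- No coefficient pair merges both basis vectors, because their determinant is `1`. -/
theorem dOpt_le (h : FareyNeighbours q n m n' m') (hq : q.Prime)
    (h1 : (m : ℝ) ≤ η * n) (h2 : η * n' ≤ m') : dOpt q η ≤ max (η * n - m) (m' - η * n') := by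
  obtain ⟨α, β, hα, -, hd⟩ := (isGreatest_optMinSetDistance hq η 1).1
  rw [dOpt, hd]
  by_cases h0 : α * n = β * m
  · refine le_trans (minSetDistance_le hq hα h.den_lt' h.num_lt' (η := η) (β := β) ?_) ?_
    · intro h0'
      have hdet := congrArg (Nat.cast : ℕ → ZMod q) h.det
      push_cast at hdet
      exact hα (by linear_combination m' * h0 - α * hdet - m * h0')
    · rw [abs_of_nonpos (by linarith)]
      exact le_max_of_le_right (by linarith)
  · refine le_trans (minSetDistance_le hq hα h.den_lt h.num_lt h0) ?_
    rw [abs_of_nonneg (by linarith)]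
    exact le_max_left _ _

theorem dOpt_eq (h : FareyNeighbours q n m n' m') (hq : q.Prime) (hn' : 0 < n')
    (h1 : (m : ℝ) ≤ η * n) (h2 : η * n' ≤ m') : dOpt q η = max (η * n - m) (m' - η * n') :=
  le_antisymm (h.dOpt_le hq h1 h2)
    (max_le (h.right_le_dOpt hq hn' h1 h2) (h.left_le_dOpt hq h1 h2))

end FareyNeighbours

/-- Beyond `q - 1` the optimum is constant: the neighbours are `(q - 1) / 1` and `1 / 0`, and no
admissible coefficient pair merges `(0, 0)` with `(0, 1)`. -/
theorem dOpt_eq_one {q : ℕ} (hq : q.Prime) {η : ℝ} (hη : (q : ℝ) - 1 ≤ η) : dOpt q η = 1 := by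
  have hq1 := hq.one_lt
  have h : FareyNeighbours q 1 (q - 1) 0 1 :=
    ⟨by omega, by omega, by omega, by omega, by omega, by omega, by omega, by omega, by omega⟩
  have h1 : ((q - 1 : ℕ) : ℝ) ≤ η * (1 : ℕ) := by
    rw [Nat.cast_sub hq1.le]; simpa using hη
  apply le_antisymm
  · obtain ⟨α, β, hα, hβ, hd⟩ := (isGreatest_optMinSetDistance hq η 1).1
    rw [dOpt, hd]
    refine le_trans (minSetDistance_le hq hα hq.pos hq1 (η := η) (β := β) ?_) ?_
    · simpa using hβ.symm
    · simp
  · simpa using h.left_le_dOpt hq h1 (by simp)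

/-! ### Monotonicity between neighbours -/

/-- The ratio at which the two distances `η n - m` and `m' - η n'` are equal. -/
noncomputable def mediantRatio (n m n' m' : ℕ) : ℝ := ((m : ℝ) + m') / (n + n')

namespace FareyNeighbours

variable {q n m n' m' : ℕ} {η : ℝ}

theorem det_real (h : FareyNeighbours q n m n' m') : (m' : ℝ) * n = m * n' + 1 := by
  exact_mod_cast h.det

theorem lt_mediant (h : FareyNeighbours q n m n' m') : (m : ℝ) / n < mediantRatio n m n' m' := by
  have hn : (0 : ℝ) < n := by exact_mod_cast h.pos
  rw [mediantRatio, div_lt_div_iff₀ hn (by positivity)]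
  linarith [h.det_real]

theorem mediant_lt (h : FareyNeighbours q n m n' m') (hn' : 0 < n') :
    mediantRatio n m n' m' < (m' : ℝ) / n' := by
  have hn : (0 : ℝ) < n' := by exact_mod_cast hn'
  rw [mediantRatio, div_lt_div_iff₀ (by positivity) hn]
  linarith [h.det_real]

theorem dOpt_eq_left (h : FareyNeighbours q n m n' m') (hq : q.Prime) (hn' : 0 < n')
    (hη : η ∈ Icc ((m : ℝ) / n) (mediantRatio n m n' m')) : dOpt q η = m' - η * n' := by
  have hn : (0 : ℝ) < n := by exact_mod_cast h.pos
  have hn0 : (0 : ℝ) < n' := by exact_mod_cast hn'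
  have h1 := (div_le_iff₀ hn).1 hη.1
  have h2 := (le_div_iff₀ hn0).1 (hη.2.trans (h.mediant_lt hn').le)
  have h3 := (le_div_iff₀ (by positivity)).1 hη.2
  rw [h.dOpt_eq hq hn' h1 h2, max_eq_right (by linarith)]

theorem dOpt_eq_right (h : FareyNeighbours q n m n' m') (hq : q.Prime) (hn' : 0 < n')
    (hη : η ∈ Icc (mediantRatio n m n' m') ((m' : ℝ) / n')) : dOpt q η = η * n - m := by
  have hn : (0 : ℝ) < n := by exact_mod_cast h.pos
  have hn0 : (0 : ℝ) < n' := by exact_mod_cast hn'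
  have h1 := (div_le_iff₀ hn).1 (h.lt_mediant.le.trans hη.1)
  have h2 := (le_div_iff₀ hn0).1 hη.2
  have h3 := (div_le_iff₀ (by positivity)).1 hη.1
  rw [h.dOpt_eq hq hn' h1 h2, max_eq_left (by linarith)]

theorem strictAntiOn (h : FareyNeighbours q n m n' m') (hq : q.Prime) (hn' : 0 < n') :
    StrictAntiOn (dOpt q) (Icc ((m : ℝ) / n) (mediantRatio n m n' m')) := by
  intro x hx y hy hxy
  rw [h.dOpt_eq_left hq hn' hx, h.dOpt_eq_left hq hn' hy]
  have hn0 : (0 : ℝ) < n' := by exact_mod_cast hn'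
  nlinarith

theorem strictMonoOn (h : FareyNeighbours q n m n' m') (hq : q.Prime) (hn' : 0 < n') :
    StrictMonoOn (dOpt q) (Icc (mediantRatio n m n' m') ((m' : ℝ) / n')) := by
  intro x hx y hy hxy
  rw [h.dOpt_eq_right hq hn' hx, h.dOpt_eq_right hq hn' hy]
  have hn : (0 : ℝ) < n := by exact_mod_cast h.pos
  nlinarith

theorem coprime (h : FareyNeighbours q n m n' m') : m.Coprime n :=
  Nat.isCoprime_iff_coprime.1 ⟨-n', m', by have := h.det; zify at this; linear_combination this⟩

theorem coprime' (h : FareyNeighbours q n m n' m') : m'.Coprime n' :=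
  Nat.isCoprime_iff_coprime.1 ⟨n, -m, by have := h.det; zify at this; linear_combination this⟩

theorem coprime_mediant (h : FareyNeighbours q n m n' m') : (m + m').Coprime (n + n') :=
  Nat.isCoprime_iff_coprime.1
    ⟨n, -m, by have := h.det; zify at this; push_cast; linear_combination this⟩

theorem dOpt_left (h : FareyNeighbours q n m n' m') (hq : q.Prime) (hn' : 0 < n') :
    dOpt q ((m : ℝ) / n) = 1 / n := by
  rw [h.dOpt_eq_left hq hn' ⟨le_rfl, h.lt_mediant.le⟩]
  have hn : (0 : ℝ) < n := by exact_mod_cast h.pos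
  field_simp
  linarith [h.det_real]

theorem dOpt_mediant (h : FareyNeighbours q n m n' m') (hq : q.Prime) (hn' : 0 < n') :
    dOpt q (mediantRatio n m n' m') = 1 / ((n : ℝ) + n') := by
  rw [h.dOpt_eq_left hq hn' ⟨h.lt_mediant.le, le_rfl⟩, mediantRatio]
  have hn : (0 : ℝ) < n := by exact_mod_cast h.pos
  field_simp
  linarith [h.det_real]

end FareyNeighbours

/-! ### Local extrema on `[1, ∞)` -/

theorem exists_mem_Ioo_right {P : ℝ → Prop} {η b : ℝ} (h1 : 1 ≤ η) (hb : η < b)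
    (h : ∀ᶠ x in 𝓝[Ici 1 \ {η}] η, P x) : ∃ x ∈ Ioo η b, P x := by
  have hsub : Ioi η ⊆ Ici 1 \ {η} := fun x hx => ⟨h1.trans (le_of_lt hx), ne_of_gt hx⟩
  have h' : ∀ᶠ x in 𝓝[>] η, P x := nhdsWithin_mono _ hsub h
  obtain ⟨x, hx, hP⟩ := ((eventually_mem_set.2 (Ioo_mem_nhdsGT hb)).and h').exists
  exact ⟨x, hx, hP⟩

theorem exists_mem_Ioo_left {P : ℝ → Prop} {a η : ℝ} (h1 : 1 ≤ a) (ha : a < η)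
    (h : ∀ᶠ x in 𝓝[Ici 1 \ {η}] η, P x) : ∃ x ∈ Ioo a η, P x := by
  have hsub : Ioo a η ⊆ Ici 1 \ {η} := fun x hx => ⟨h1.trans (le_of_lt hx.1), ne_of_lt hx.2⟩
  have h' : ∀ᶠ x in 𝓝[<] η, P x := by
    rw [← nhdsWithin_Ioo_eq_nhdsLT ha]
    exact nhdsWithin_mono _ hsub h
  obtain ⟨x, hx, hP⟩ := ((eventually_mem_set.2 (Ioo_mem_nhdsLT ha)).and h').exists
  exact ⟨x, hx, hP⟩

theorem eventually_punctured {P : ℝ → Prop} {a η b : ℝ} (ha : a < η) (hb : η < b)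
    (hl : ∀ x, 1 ≤ x → a < x → x < η → P x) (hr : ∀ x, η < x → x < b → P x) :
    ∀ᶠ x in 𝓝[Ici 1 \ {η}] η, P x := by
  rw [eventually_nhdsWithin_iff]
  filter_upwards [Ioo_mem_nhds ha hb] with x hx hx1
  rcases lt_or_gt_of_ne (show x ≠ η from hx1.2) with h | h
  · exact hl x hx1.1 hx.1 h
  · exact hr x h hx.2

section Monotone

variable {q : ℕ} {a b η : ℝ}

theorem not_odd_of_strictAntiOn (h1 : 1 ≤ a) (h : StrictAntiOn (dOpt q) (Icc a b))
    (hη : η ∈ Ico a b) : η ∉ oddTurningPoints q := fun ⟨_, ho⟩ => by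
  obtain ⟨x, hx, hP⟩ := exists_mem_Ioo_right (h1.trans hη.1) hη.2 ho
  exact lt_asymm hP (h ⟨hη.1, hη.2.le⟩ ⟨hη.1.trans hx.1.le, hx.2.le⟩ hx.1)

theorem not_even_of_strictAntiOn (h1 : 1 ≤ a) (h : StrictAntiOn (dOpt q) (Icc a b))
    (hη : η ∈ Ioc a b) : η ∉ evenTurningPoints q := fun ⟨_, ho⟩ => by
  obtain ⟨x, hx, hP⟩ := exists_mem_Ioo_left h1 hη.1 ho
  exact lt_asymm hP (h ⟨hx.1.le, hx.2.le.trans hη.2⟩ ⟨hη.1.le, hη.2⟩ hx.2)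

theorem not_even_of_strictMonoOn (h1 : 1 ≤ a) (h : StrictMonoOn (dOpt q) (Icc a b))
    (hη : η ∈ Ico a b) : η ∉ evenTurningPoints q := fun ⟨_, ho⟩ => by
  obtain ⟨x, hx, hP⟩ := exists_mem_Ioo_right (h1.trans hη.1) hη.2 ho
  exact lt_asymm hP (h ⟨hη.1, hη.2.le⟩ ⟨hη.1.trans hx.1.le, hx.2.le⟩ hx.1)

theorem not_odd_of_strictMonoOn (h1 : 1 ≤ a) (h : StrictMonoOn (dOpt q) (Icc a b))
    (hη : η ∈ Ioc a b) : η ∉ oddTurningPoints q := fun ⟨_, ho⟩ => by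
  obtain ⟨x, hx, hP⟩ := exists_mem_Ioo_left h1 hη.1 ho
  exact lt_asymm hP (h ⟨hx.1.le, hx.2.le.trans hη.2⟩ ⟨hη.1.le, hη.2⟩ hx.2)

theorem lt_of_even_or_odd (hq : q.Prime) (hη : η ∈ evenTurningPoints q ∪ oddTurningPoints q) :
    η < (q : ℝ) - 1 := by
  by_contra! hc
  have h0 := dOpt_eq_one hq hc
  rcases hη with ⟨h1, h⟩ | ⟨h1, h⟩ <;>
  · obtain ⟨x, hx, hP⟩ := exists_mem_Ioo_right h1 (lt_add_one η) h
    rw [h0, dOpt_eq_one hq (hc.trans hx.1.le)] at hP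
    exact lt_irrefl _ hP

end Monotone

/-! ### The chain of all reduced fractions in `[1, q - 1]` -/

/-- The fractions `m 1 / n 1 < ⋯ < m (N + 1) / n (N + 1)` lead from `1` to `q - 1`, and any two
consecutive ones are neighbours. -/
structure FareyChain (q N : ℕ) (n m : ℕ → ℕ) : Prop where
  neighbours : ∀ i, 1 ≤ i → i ≤ N → FareyNeighbours q (n i) (m i) (n (i + 1)) (m (i + 1))
  pos : ∀ i, 1 ≤ i → i ≤ N + 1 → 0 < n i
  one_le : ∀ i, 1 ≤ i → i ≤ N + 1 → (1 : ℝ) ≤ m i / n i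
  mono : StrictMonoOn (fun i => (m i : ℝ) / n i) (Icc 1 (N + 1))
  first : (m 1 : ℝ) / n 1 = 1
  last : (m (N + 1) : ℝ) / n (N + 1) = (q : ℝ) - 1

namespace FareyChain

variable {q N : ℕ} {n m : ℕ → ℕ}

theorem exists_mem (h : FareyChain q N n m) {η : ℝ} (h1 : 1 ≤ η) (hη : η < (q : ℝ) - 1) :
    ∃ i, 1 ≤ i ∧ i ≤ N ∧ (m i : ℝ) / n i ≤ η ∧ η < (m (i + 1) : ℝ) / n (i + 1) := by
  by_contra! hcon
  have key : ∀ j, j ≤ N → (m (j + 1) : ℝ) / n (j + 1) ≤ η := by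
    intro j
    induction j with
    | zero => intro _; rw [zero_add, h.first]; exact h1
    | succ j ih => intro hj; exact hcon (j + 1) (by omega) hj (ih (by omega))
  have := key N le_rfl
  rw [h.last] at this
  linarith

theorem mediant_mono (h : FareyChain q N n m) :
    StrictMonoOn (fun i => mediantRatio (n i) (m i) (n (i + 1)) (m (i + 1))) (Icc 1 N) := by
  rintro i ⟨hi1, hi2⟩ j ⟨hj1, hj2⟩ hij
  refine ((h.neighbours i hi1 hi2).mediant_lt (h.pos _ (by omega) (by omega))).trans
    (lt_of_le_of_lt ?_ (h.neighbours j hj1 hj2).lt_mediant)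
  exact h.mono.monotoneOn ⟨by omega, by omega⟩ ⟨hj1, by omega⟩ hij

theorem mem_even (h : FareyChain q N n m) (hq : q.Prime) {i : ℕ} (h1 : 1 ≤ i) (hi : i ≤ N) :
    (m i : ℝ) / n i ∈ evenTurningPoints q := by
  have hF := h.neighbours i h1 hi
  have hr := hF.strictAntiOn hq (h.pos _ (by omega) (by omega))
  have hlt := hF.lt_mediant
  refine ⟨h.one_le i h1 (by omega), ?_⟩
  have hr' : ∀ x, (m i : ℝ) / n i < x → x < mediantRatio (n i) (m i) (n (i + 1)) (m (i + 1)) →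
      dOpt q x < dOpt q ((m i : ℝ) / n i) :=
    fun x hx1 hx2 => hr ⟨le_rfl, hlt.le⟩ ⟨hx1.le, hx2.le⟩ hx1
  obtain rfl | h2 : i = 1 ∨ 1 < i := by omega
  · exact eventually_punctured (sub_one_lt _) hlt
      (fun x hx _ hx' => absurd hx' (by rw [h.first]; exact not_lt.2 hx)) hr'
  · obtain ⟨j, rfl⟩ : ∃ j, i = j + 1 := ⟨i - 1, by omega⟩
    have hF' := h.neighbours j (by omega) (by omega)
    have hp := h.pos (j + 1) h1 (by omega)
    have hl := hF'.strictMonoOn hq hp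
    have hlt' := hF'.mediant_lt hp
    exact eventually_punctured hlt' hlt
      (fun x _ hx hx' => hl ⟨hx.le, hx'.le⟩ ⟨hlt'.le, le_rfl⟩ hx') hr'

theorem mem_odd (h : FareyChain q N n m) (hq : q.Prime) {i : ℕ} (h1 : 1 ≤ i) (hi : i ≤ N) :
    mediantRatio (n i) (m i) (n (i + 1)) (m (i + 1)) ∈ oddTurningPoints q := by
  have hF := h.neighbours i h1 hi
  have hp := h.pos (i + 1) (by omega) (by omega)
  have hlt := hF.lt_mediant
  have hlt' := hF.mediant_lt hp
  exact ⟨(h.one_le i h1 (by omega)).trans hlt.le, eventually_punctured hlt hlt'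
    (fun x _ hx hx' => hF.strictAntiOn hq hp ⟨hx.le, hx'.le⟩ ⟨hlt.le, le_rfl⟩ hx')
    (fun x hx hx' => hF.strictMonoOn hq hp ⟨le_rfl, hlt'.le⟩ ⟨hx.le, hx'.le⟩ hx)⟩

theorem even_eq (h : FareyChain q N n m) (hq : q.Prime) :
    evenTurningPoints q = (fun i => (m i : ℝ) / n i) '' Icc 1 N := by
  apply Subset.antisymm
  · intro η hη
    obtain ⟨i, h1, hi, hl, hr⟩ := h.exists_mem hη.1 (lt_of_even_or_odd hq (Or.inl hη))
    have hF := h.neighbours i h1 hi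
    have hp := h.pos (i + 1) (by omega) (by omega)
    have h1i := h.one_le i h1 (by omega)
    refine ⟨i, ⟨h1, hi⟩, hl.antisymm (not_lt.1 fun hlt => ?_)⟩
    rcases le_or_gt η (mediantRatio (n i) (m i) (n (i + 1)) (m (i + 1))) with hm | hm
    · exact not_even_of_strictAntiOn h1i (hF.strictAntiOn hq hp) ⟨hlt, hm⟩ hη
    · exact not_even_of_strictMonoOn (h1i.trans hF.lt_mediant.le) (hF.strictMonoOn hq hp)
        ⟨hm.le, hr⟩ hη
  · rintro _ ⟨i, ⟨h1, hi⟩, rfl⟩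
    exact h.mem_even hq h1 hi

theorem odd_eq (h : FareyChain q N n m) (hq : q.Prime) :
    oddTurningPoints q =
      (fun i => mediantRatio (n i) (m i) (n (i + 1)) (m (i + 1))) '' Icc 1 N := by
  apply Subset.antisymm
  · intro η hη
    obtain ⟨i, h1, hi, hl, hr⟩ := h.exists_mem hη.1 (lt_of_even_or_odd hq (Or.inr hη))
    have hF := h.neighbours i h1 hi
    have hp := h.pos (i + 1) (by omega) (by omega)
    have h1i := h.one_le i h1 (by omega)
    refine ⟨i, ⟨h1, hi⟩, ?_⟩
    rcases lt_trichotomy η (mediantRatio (n i) (m i) (n (i + 1)) (m (i + 1))) with hm | hm | hm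
    · exact (not_odd_of_strictAntiOn h1i (hF.strictAntiOn hq hp) ⟨hl, hm⟩ hη).elim
    · exact hm.symm
    · exact (not_odd_of_strictMonoOn (h1i.trans hF.lt_mediant.le) (hF.strictMonoOn hq hp)
        ⟨hm, hr.le⟩ hη).elim
  · rintro _ ⟨i, ⟨h1, hi⟩, rfl⟩
    exact h.mem_odd hq h1 hi

end FareyChain

/-! ### Characteristic symbols -/

/-- Two affine functions of equal absolute value on a nondegenerate interval agree up to sign. -/
theorem eq_of_sq_eq_sq {a c p r : ℕ} {x y : ℝ} (ha : 0 < a) (hxy : x < y)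
    (h : ∀ η ∈ Icc x y, (η * a - c) ^ 2 = (η * p - r) ^ 2) : a = p ∧ c = r := by
  have h1 := h x ⟨le_rfl, hxy.le⟩
  have h2 := h y ⟨hxy.le, le_rfl⟩
  have h3 := h ((x + y) / 2) ⟨by linarith, by linarith⟩
  have ha' : (0 : ℝ) < a := by exact_mod_cast ha
  have hne : y - x ≠ 0 := sub_ne_zero.2 hxy.ne'
  -- Second and first differences of the quadratic polynomial.
  have hA : ((a : ℝ) ^ 2 - p ^ 2) = 0 := by
    have : (y - x) ^ 2 * ((a : ℝ) ^ 2 - p ^ 2) = 0 := by linear_combination 2 * h1 + 2 * h2 - 4 * h3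
    exact (mul_eq_zero.1 this).resolve_left (pow_ne_zero 2 hne)
  have hap : (a : ℝ) = p := by
    nlinarith [(Nat.cast_nonneg p : (0 : ℝ) ≤ p)]
  have hB : (a : ℝ) * (c - r) = 0 := by
    have : (y - x) * ((a : ℝ) * (c - r)) = 0 := by
      rw [← hap] at h1 h2
      linear_combination (h1 - h2) / 2
    exact (mul_eq_zero.1 this).resolve_left hne
  have hcr := sub_eq_zero.1 ((mul_eq_zero.1 hB).resolve_left ha'.ne')
  exact ⟨by exact_mod_cast hap, by exact_mod_cast hcr⟩

/-- The symbols whose overlap ratio, written as `(q - 1 - w_B) / w_A`, is a reduced fraction in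
`[1, q - 1]`. -/
def fareySymbols (q : ℕ) : Set (JointSymbol q) :=
  {w | 0 < (w.1 : ℕ) ∧ (w.1 : ℕ) ≤ q - 1 - (w.2 : ℕ) ∧
    (w.1 : ℕ).Coprime (q - 1 - (w.2 : ℕ))}

theorem natCast_num {q : ℕ} (w : JointSymbol q) :
    ((q - 1 - (w.2 : ℕ) : ℕ) : ℝ) = (q : ℝ) - 1 - (w.2 : ℕ) := by
  have := w.2.isLt
  rw [Nat.cast_sub (by omega), Nat.cast_sub (by omega), Nat.cast_one]

theorem overlapRatio_eq {q : ℕ} (w : JointSymbol q) :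
    overlapRatio w = ((q - 1 - (w.2 : ℕ) : ℕ) : ℝ) / (w.1 : ℕ) := by
  rw [natCast_num, overlapRatio]

theorem superimposed_sub_ref {q : ℕ} (η : ℝ) (w : JointSymbol q) :
    superimposed η 1 w - ((q : ℝ) - 1) = η * (w.1 : ℕ) - ((q - 1 - (w.2 : ℕ) : ℕ) : ℝ) := by
  rw [natCast_num, superimposed]; ring

theorem coprime_eq_of_div_eq {m n m' n' : ℕ} (hn : 0 < n) (hn' : 0 < n') (h : m.Coprime n)
    (h' : m'.Coprime n') (he : (m : ℝ) / n = m' / n') : m = m' ∧ n = n' := by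
  rw [div_eq_div_iff (by positivity) (by positivity)] at he
  norm_cast at he
  have h1 : n = n' := Nat.dvd_antisymm
    (h.symm.dvd_of_dvd_mul_left ⟨m', by rw [he, mul_comm]⟩)
    (h'.symm.dvd_of_dvd_mul_left ⟨m, by rw [← he, mul_comm]⟩)
  subst h1
  exact ⟨Nat.eq_of_mul_eq_mul_right hn he, rfl⟩

theorem overlapRatio_injOn (q : ℕ) : InjOn overlapRatio (fareySymbols q) := by
  rintro ⟨a, b⟩ ⟨h1, -, h2⟩ ⟨a', b'⟩ ⟨h1', -, h2'⟩ he
  rw [overlapRatio_eq, overlapRatio_eq] at he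
  obtain ⟨h3, h4⟩ := coprime_eq_of_div_eq h1 h1' h2.symm h2'.symm he
  dsimp only at h3 h4
  ext <;> dsimp only <;> omega

theorem exists_fareySymbol {q a c : ℕ} (ha : 0 < a) (hac : a ≤ c) (hc : c < q)
    (hco : a.Coprime c) :
    ∃ w ∈ fareySymbols q, (w.1 : ℕ) = a ∧ q - 1 - (w.2 : ℕ) = c := by
  refine ⟨(⟨a, by omega⟩, ⟨q - 1 - c, by omega⟩), ?_, rfl, ?_⟩
  · have : q - 1 - (q - 1 - c) = c := by omega
    simp only [fareySymbols, mem_ofPred_eq, this]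
    exact ⟨ha, hac, hco⟩
  · dsimp only; omega

theorem exists_listsInOrder {X : Type} [Nonempty X] (key : X → ℝ) {S : Set X} (hS : S.Finite)
    (hinj : InjOn key S) : ∃ (N : ℕ) (s : ℕ → X), ListsInOrder key S N s := by
  classical
  let T : Finset ℝ := hS.toFinset.image key
  have hT : ∀ t, t ∈ T ↔ ∃ x ∈ S, key x = t := by simp [T]
  let e := T.orderEmbOfFin rfl
  have hg : ∀ j, Function.invFunOn key S (e j) ∈ S ∧ key (Function.invFunOn key S (e j)) = e j :=
    fun j => Function.invFunOn_pos ((hT _).1 (T.orderEmbOfFin_mem rfl j))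
  let s : ℕ → X := fun i =>
    if h : i - 1 < T.card then Function.invFunOn key S (e ⟨i - 1, h⟩) else Classical.arbitrary X
  have hs : ∀ i (h : i - 1 < T.card), s i = Function.invFunOn key S (e ⟨i - 1, h⟩) :=
    fun i h => dif_pos h
  have hmono : StrictMonoOn (fun i => key (s i)) (Icc 1 T.card) := by
    rintro i ⟨hi, hi'⟩ j ⟨hj, hj'⟩ hij
    dsimp only
    rw [hs i (by omega), hs j (by omega), (hg _).2, (hg _).2]
    exact e.strictMono (show i - 1 < j - 1 by omega)
  refine ⟨T.card, s, ⟨?_, fun i hi j hj h => hmono.injOn hi hj (congrArg key h), ?_⟩, hmono⟩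
  · rintro i ⟨hi, hi'⟩
    rw [hs i (by omega)]
    exact (hg _).1
  · intro x hx
    obtain ⟨j, hj⟩ : key x ∈ Set.range e := by
      rw [Finset.range_orderEmbOfFin]; exact (hT _).2 ⟨x, hx, rfl⟩
    refine ⟨j + 1, ⟨by omega, j.isLt⟩, ?_⟩
    rw [hs (j + 1) j.isLt]
    exact hinj (hg _).1 hx ((hg _).2.trans hj)

/-- The list of all reduced fractions in `[1, q - 1]` is a chain. -/
theorem fareyChain_of_lists {q N : ℕ} {w : ℕ → JointSymbol q} (hq : 1 < q)
    (h : ListsInOrder overlapRatio (fareySymbols q) (N + 1) w) :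
    FareyChain q N (fun i => ((w i).1 : ℕ)) (fun i => q - 1 - ((w i).2 : ℕ)) := by
  obtain ⟨hbij, hmono⟩ := h
  have hmem : ∀ i, 1 ≤ i → i ≤ N + 1 → w i ∈ fareySymbols q := fun i h1 h2 => hbij.mapsTo ⟨h1, h2⟩
  have hmono' : StrictMonoOn
      (fun i => ((q - 1 - ((w i).2 : ℕ) : ℕ) : ℝ) / ((w i).1 : ℕ)) (Icc 1 (N + 1)) := by
    simpa only [overlapRatio_eq] using hmono
  have hsurj : ∀ a c : ℕ, 0 < a → a ≤ c → c < q → a.Coprime c →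
      ∃ j, 1 ≤ j ∧ j ≤ N + 1 ∧ ((w j).1 : ℕ) = a ∧ q - 1 - ((w j).2 : ℕ) = c := by
    intro a c ha hac hc hco
    obtain ⟨v, hv, rfl, rfl⟩ := exists_fareySymbol ha hac hc hco
    obtain ⟨j, ⟨h1, h2⟩, rfl⟩ := hbij.surjOn hv
    exact ⟨j, h1, h2, rfl, rfl⟩
  have hpos : ∀ i, 1 ≤ i → i ≤ N + 1 → (0 : ℝ) < ((w i).1 : ℕ) := fun i h1 h2 => by
    exact_mod_cast (hmem i h1 h2).1
  have hone : ∀ i, 1 ≤ i → i ≤ N + 1 →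
      (1 : ℝ) ≤ ((q - 1 - ((w i).2 : ℕ) : ℕ) : ℝ) / ((w i).1 : ℕ) := fun i h1 h2 => by
    rw [one_le_div (hpos i h1 h2)]
    exact_mod_cast (hmem i h1 h2).2.1
  have hlt : ∀ i j, 1 ≤ i → i ≤ N + 1 → 1 ≤ j → j ≤ N + 1 →
      ((q - 1 - ((w i).2 : ℕ)) * ((w j).1 : ℕ) < (q - 1 - ((w j).2 : ℕ)) * ((w i).1 : ℕ) ↔
        i < j) := by
    intro i j hi hi' hj hj'
    rw [← hmono'.lt_iff_lt ⟨hi, hi'⟩ ⟨hj, hj'⟩]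
    rw [div_lt_div_iff₀ (hpos i hi hi') (hpos j hj hj')]
    norm_cast
  refine ⟨fun i h1 h2 => ?_, fun i h1 h2 => (hmem i h1 h2).1, hone, hmono', ?_, ?_⟩
  · obtain ⟨ha, hb, hc⟩ := hmem i h1 (by omega)
    obtain ⟨ha', hb', hc'⟩ := hmem (i + 1) (by omega) (by omega)
    refine FareyNeighbours.of_gap ha hb (by omega) hc ha' hb' (by omega) hc'
      ((hlt i (i + 1) h1 (by omega) (by omega) (by omega)).2 (by omega)) ?_
    intro a c h3 h4 h5 h6 h7 h8
    obtain ⟨j, hj1, hj2, rfl, rfl⟩ := hsurj a c h3 h4 h5 h6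
    rw [hlt i j h1 (by omega) hj1 hj2] at h7
    rw [hlt j (i + 1) hj1 hj2 (by omega) (by omega)] at h8
    omega
  · obtain ⟨j, hj1, hj2, h3, h4⟩ := hsurj 1 1 one_pos le_rfl hq (Nat.coprime_one_left 1)
    refine le_antisymm ?_ (hone 1 le_rfl (by omega))
    have := hmono'.monotoneOn ⟨le_rfl, by omega⟩ ⟨hj1, hj2⟩ hj1
    simpa [h3, h4] using this
  · obtain ⟨j, hj1, hj2, h3, h4⟩ := hsurj 1 (q - 1) one_pos (by omega) (by omega)
      (Nat.coprime_one_left _)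
    have hcast : ((q - 1 : ℕ) : ℝ) = q - 1 := by rw [Nat.cast_sub hq.le, Nat.cast_one]
    apply le_antisymm
    · have h5 : (1 : ℝ) ≤ ((w (N + 1)).1 : ℕ) := by
        exact_mod_cast (hmem (N + 1) (by omega) le_rfl).1
      rw [div_le_iff₀ (by linarith), ← hcast]
      have h6 : ((q - 1 - ((w (N + 1)).2 : ℕ) : ℕ) : ℝ) ≤ ((q - 1 : ℕ) : ℝ) := by
        exact_mod_cast Nat.sub_le _ _
      nlinarith [(Nat.cast_nonneg (q - 1) : (0 : ℝ) ≤ ((q - 1 : ℕ) : ℝ))]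
    · have := hmono'.monotoneOn ⟨hj1, hj2⟩ ⟨by omega, le_rfl⟩ hj2
      simpa [h3, h4, hcast] using this

theorem isDetermining_iff {q : ℕ} {η : ℝ} {w : JointSymbol q} :
    IsDetermining q η w ↔ |η * (w.1 : ℕ) - ((q - 1 - (w.2 : ℕ) : ℕ) : ℝ)| = dOpt q η := by
  rw [IsDetermining, superimposed_sub_ref]

/-- A characteristic symbol gives the linear piece of the optimal distance to the right of the left
end of its interval; that piece is not constant, so it lies between two neighbours. -/
theorem exists_of_mem_characteristicSymbols {q N : ℕ} {n m : ℕ → ℕ} (hq : q.Prime)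
    (h : FareyChain q N n m) {w : JointSymbol q} (hw : w ∈ characteristicSymbols q) :
    w ∈ fareySymbols q ∧ 1 ≤ N := by
  obtain ⟨⟨-, hle, hpos⟩, x, y, hx, hxy, hdet⟩ := hw
  have hle' : (w.1 : ℕ) ≤ q - 1 - (w.2 : ℕ) := by omega
  have hsq : ∀ η ∈ Icc x y,
      (η * (w.1 : ℕ) - ((q - 1 - (w.2 : ℕ) : ℕ) : ℝ)) ^ 2 = dOpt q η ^ 2 := fun η hη => by
    rw [← isDetermining_iff.1 (hdet η hη), sq_abs]
  rcases le_or_gt ((q : ℝ) - 1) x with hc | hc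
  · have := (eq_of_sq_eq_sq (p := 0) (r := 1) hpos hxy fun η hη => by
      rw [hsq η hη, dOpt_eq_one hq (hc.trans hη.1)]; simp).1
    omega
  obtain ⟨i, h1, hi, hl, hr⟩ := h.exists_mem hx hc
  refine ⟨?_, h1.trans hi⟩
  have hF := h.neighbours i h1 hi
  have hp := h.pos (i + 1) (by omega) (by omega)
  rcases lt_or_ge x (mediantRatio (n i) (m i) (n (i + 1)) (m (i + 1))) with hm | hm
  · obtain ⟨h2, h3⟩ := eq_of_sq_eq_sq (p := n (i + 1)) (r := m (i + 1)) hpos (lt_min hxy hm)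
      fun η hη => by
        rw [hsq η ⟨hη.1, hη.2.trans (min_le_left _ _)⟩,
          hF.dOpt_eq_left hq hp ⟨hl.trans hη.1, hη.2.trans (min_le_right _ _)⟩]
        ring
    exact ⟨hpos, hle', by rw [h2, h3]; exact hF.coprime'.symm⟩
  · obtain ⟨h2, h3⟩ := eq_of_sq_eq_sq (p := n i) (r := m i) hpos (lt_min hxy hr)
      fun η hη => by
        rw [hsq η ⟨hη.1, hη.2.trans (min_le_left _ _)⟩,
          hF.dOpt_eq_right hq hp ⟨hm.trans hη.1, hη.2.trans (min_le_right _ _)⟩]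
    exact ⟨hpos, hle', by rw [h2, h3]; exact hF.coprime.symm⟩

theorem characteristicSymbols_eq {q N : ℕ} {w : ℕ → JointSymbol q} (hq : q.Prime) (hN : 1 ≤ N)
    (hw : ListsInOrder overlapRatio (fareySymbols q) (N + 1) w) :
    characteristicSymbols q = fareySymbols q := by
  have h := fareyChain_of_lists hq.one_lt hw
  apply Subset.antisymm
  · exact fun v hv => (exists_of_mem_characteristicSymbols hq h hv).1
  · intro v hv
    obtain ⟨i, ⟨h1, hi⟩, rfl⟩ := hw.1.surjOn hv
    have h1i := h.one_le i h1 hi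
    refine ⟨⟨by have := hv.1; omega, by have := hv.2.1; omega, hv.1⟩, ?_⟩
    obtain hi' | rfl : i ≤ N ∨ i = N + 1 := by omega
    · have hF := h.neighbours i h1 hi'
      have hp := h.pos (i + 1) (by omega) (by omega)
      refine ⟨_, _, h1i.trans hF.lt_mediant.le, hF.mediant_lt hp, fun η hη => ?_⟩
      have hn : (0 : ℝ) < ((w i).1 : ℕ) := by exact_mod_cast hv.1
      have := (div_le_iff₀ hn).1 (hF.lt_mediant.le.trans hη.1)
      rw [isDetermining_iff, hF.dOpt_eq_right hq hp hη, abs_of_nonneg (by linarith)]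
    · have hF := h.neighbours N hN le_rfl
      have hp := h.pos (N + 1) (by omega) le_rfl
      refine ⟨_, _, h.one_le N hN (by omega), hF.lt_mediant, fun η hη => ?_⟩
      have hn : (0 : ℝ) < ((w (N + 1)).1 : ℕ) := by exact_mod_cast hv.1
      have := (le_div_iff₀ hn).1 (hη.2.trans (hF.mediant_lt hp).le)
      rw [isDetermining_iff, hF.dOpt_eq_left hq hp hη, abs_of_nonpos (by linarith), neg_sub]

/-! ### The turning points -/

theorem listsInOrder_image {f : ℕ → ℝ} {N : ℕ} {S : Set ℝ} (hf : StrictMonoOn f (Icc 1 N))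
    (hS : S = f '' Icc 1 N) : ListsInOrder id S N f :=
  ⟨hS ▸ hf.injOn.bijOn_image, hf⟩

theorem exists_coprime_and_dOpt_eq {q k l : ℕ} {η : ℝ} (hl : 0 < l) (hco : k.Coprime l)
    (hη : η = (k : ℝ) / l) (hd : dOpt q η = 1 / l) :
    (∃ m n : ℕ, 0 < n ∧ Nat.Coprime m n ∧ η = (m : ℝ) / n) ∧
      ∀ m n : ℕ, 0 < n → Nat.Coprime m n → η = (m : ℝ) / n → dOpt q η = 1 / n := by
  refine ⟨⟨k, l, hl, hco, hη⟩, fun m n hn hmn h => ?_⟩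
  rw [hd, (coprime_eq_of_div_eq hl hn hco hmn (hη.symm.trans h)).2]

theorem corollary4 (q : ℕ) (hq : q.Prime) :
    (∀ η ∈ evenTurningPoints q ∪ oddTurningPoints q,
      (∃ m n : ℕ, 0 < n ∧ Nat.Coprime m n ∧ η = (m : ℝ) / n) ∧
      ∀ m n : ℕ, 0 < n → Nat.Coprime m n → η = (m : ℝ) / n → dOpt q η = 1 / n) ∧
    ∃ (I : ℕ) (w : ℕ → JointSymbol q) (ηe ηo : ℕ → ℝ),
      ListsInOrder overlapRatio (characteristicSymbols q) I w ∧
      ListsInOrder id (evenTurningPoints q) (I - 1) ηe ∧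
      ListsInOrder id (oddTurningPoints q) (I - 1) ηo ∧
      ∀ i ∈ Set.Icc 1 (I - 1),
        dOpt q (ηe i) = 1 / (((w i).1 : ℕ) : ℝ) ∧
        dOpt q (ηo i) = 1 / ((((w i).1 : ℕ) : ℝ) + (((w (i + 1)).1 : ℕ) : ℝ)) := by
  have hq1 := hq.one_lt
  obtain ⟨v, hv, -⟩ := exists_fareySymbol one_pos le_rfl hq1 (Nat.coprime_one_left 1)
  have : Nonempty (JointSymbol q) := ⟨v⟩
  obtain ⟨M, w, hw⟩ := exists_listsInOrder overlapRatio (toFinite _) (overlapRatio_injOn q)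
  obtain ⟨N, rfl⟩ : ∃ N, M = N + 1 := by
    obtain ⟨j, hj, -⟩ := hw.1.surjOn hv
    exact ⟨M - 1, by have := hj.1; have := hj.2; omega⟩
  have h := fareyChain_of_lists hq1 hw
  refine ⟨?_, ?_⟩
  · rintro η (hη | hη)
    · rw [h.even_eq hq] at hη
      obtain ⟨i, ⟨h1, hi⟩, rfl⟩ := hη
      have hF := h.neighbours i h1 hi
      exact exists_coprime_and_dOpt_eq hF.pos hF.coprime rfl
        (hF.dOpt_left hq (h.pos _ (by omega) (by omega)))
    · rw [h.odd_eq hq] at hη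
      obtain ⟨i, ⟨h1, hi⟩, rfl⟩ := hη
      have hF := h.neighbours i h1 hi
      refine exists_coprime_and_dOpt_eq (Nat.add_pos_left hF.pos _) hF.coprime_mediant
        (by simp [mediantRatio]) ?_
      rw [Nat.cast_add]
      exact hF.dOpt_mediant hq (h.pos _ (by omega) (by omega))
  have he := listsInOrder_image (h.mono.mono (Icc_subset_Icc_right (Nat.le_succ N)))
    (h.even_eq hq)
  have ho := listsInOrder_image h.mediant_mono (h.odd_eq hq)
  rcases Nat.eq_zero_or_pos N with rfl | hN
  · -- For `q = 2` the function is constant on `[1, ∞)` and there are no characteristic symbols.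
    refine ⟨0, w, _, _, ?_, he, ho, fun i hi => absurd (hi.1.trans hi.2) (by norm_num)⟩
    have hempty : characteristicSymbols q = ∅ := eq_empty_of_forall_notMem fun v hv =>
      absurd (exists_of_mem_characteristicSymbols hq h hv).2 (by norm_num)
    rw [hempty]
    simp [ListsInOrder, StrictMonoOn, BijOn]
  · refine ⟨N + 1, w, _, _, (characteristicSymbols_eq hq hN hw).symm ▸ hw, he, ho, ?_⟩
    rintro i ⟨h1, hi⟩
    have hF := h.neighbours i h1 hi
    have hp := h.pos (i + 1) (by omega) (by simp at hi; omega)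
    exact ⟨hF.dOpt_left hq hp, hF.dOpt_mediant hq hp⟩
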